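/- Let $s\ge 3$ be a fixed integer, and let $\kappa=1$ if $s\ge 4$ and $\kappa=\tfrac12$ if $s=3$. Let $r=r(n)$ be integers with $2\le r=o(n^{\kappa})$, and let $\mathcal{G}(n,r,s)$ be chosen uniformly at random from the set of all simple, $r$-regular, $s$-uniform hypergraphs on the vertex set $\{1,\dots,n\}$ (simple: the edges form a set of $s$-element sets of vertices; $r$-regular: every vertex lies in exactly $r$ edges). For $1\le\ell\le s-1$, an $\ell$-overlapping Hamilton cycle is a set of $n/(s-\ell)$ edges (where $s-\ell$ divides $n$) which can be labelled $e_0,e_1,\dots,e_{n/(s-\ell)-1}$ so that, for some ordering $v_0,\dots,v_{n-1}$ of the vertices, $e_i=\{v_{i(s-\ell)},v_{i(s-\ell)+1},\dots,v_{i(s-\ell)+s-1}\}$ for all $i$, with vertex indices read modulo $n$. Then for every $\ell=2,\dots,s-1$, the probability that $\mathcal{G}(n,r,s)$ has no $\ell$-overlapping Hamilton cycle tends to $1$ as $n\to\infty$ along the positive integers $n$ with $s\mid rn$ and $(s-\ell)\mid n$. -/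

import Mathlib

open Filter Topology Asymptotics

/-- The set `S(n,r,s)` of all simple, `r`-regular, `s`-uniform hypergraphs on an `n`-element
vertex set. A simple hypergraph is a set of edges, each of them a set of vertices. -/
def regularHypergraphs (n r s : ℕ) : Finset (Finset (Finset (Fin n))) :=
  Finset.univ.filter fun E =>
    (∀ e ∈ E, e.card = s) ∧ ∀ v : Fin n, (E.filter fun e => v ∈ e).card = r

open Classical in
/-- The probability that the uniformly random element `G(n,r,s)` of `S(n,r,s)` has the
property `P`. It is `0` if `S(n,r,s)` is empty, so a sequence of such probabilities can tend
to `1` only if `S(n,r,s)` is eventually nonempty. -/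
noncomputable def probRegular (n r s : ℕ) (P : Finset (Finset (Fin n)) → Prop) : ℝ :=
  (((regularHypergraphs n r s).filter P).card : ℝ) / ((regularHypergraphs n r s).card : ℝ)

/-- For an ordering `v` of the vertices with indices read cyclically, the vertex set
`{v_{i(s-ℓ)}, v_{i(s-ℓ)+1}, …, v_{i(s-ℓ)+s-1}}`. -/
def cycleEdge {n : ℕ} (s ℓ : ℕ) (v : ZMod n ≃ Fin n) (i : ℕ) : Finset (Fin n) :=
  (Finset.range s).image fun j => v ((i * (s - ℓ) + j : ℕ) : ZMod n)

/-- `C` is an `ℓ`-overlapping Hamilton cycle (of `s`-element edges): a set of exactly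
`n/(s-ℓ)` edges that can be labelled `e_0, e_1, …` so that, for some ordering `v` of all the
vertices, `e_i` is the `i`-th edge `cycleEdge s ℓ v i`. -/
def IsOverlappingHamiltonCycle {n : ℕ} (s ℓ : ℕ) (C : Finset (Finset (Fin n))) : Prop :=
  (s - ℓ) ∣ n ∧ C.card = n / (s - ℓ) ∧
    ∃ v : ZMod n ≃ Fin n, C = (Finset.range (n / (s - ℓ))).image (cycleEdge s ℓ v)

/-- The hypergraph with edge set `E` contains an `ℓ`-overlapping Hamilton cycle. -/
def HasOverlappingHamiltonCycle {n : ℕ} (s ℓ : ℕ) (E : Finset (Finset (Fin n))) : Prop :=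
  ∃ C ⊆ E, IsOverlappingHamiltonCycle s ℓ C

/-- The set of positive integers `n` with `s ∣ r(n) n` and `(s - ℓ) ∣ n`. -/
def admissible (r : ℕ → ℕ) (s ℓ : ℕ) : Set ℕ :=
  {n | 0 < n ∧ s ∣ r n * n ∧ (s - ℓ) ∣ n}

/-- The filter of `n → ∞` along the admissible integers. -/
def admissibleAtTop (r : ℕ → ℕ) (s ℓ : ℕ) : Filter ℕ :=
  atTop ⊓ 𝓟 (admissible r s ℓ)

/-- The exponent `κ(s)`, equal to `1` if `s ≥ 4` and to `1/2` if `s = 3`. -/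
noncomputable def kappa (s : ℕ) : ℝ := if 4 ≤ s then 1 else 1 / 2

/-! The proof is a first-moment bound on an initial stretch of the cycle. With `t = n / (4 * s)`,
the first `t` edges form a path on `t(s-ℓ)+ℓ` vertices, so there are at most `n ^ (t(s-ℓ)+ℓ)`
candidates. A fixed set of `t` edges lies in the random hypergraph with probability at most `(C r /
n^(s-1))^t`, where `C` depends only on `s`. The union bound is therefore `n^ℓ (C r n^(1-ℓ))^t`. As
`ℓ ≥ 2` and `r = o(n)`, it is eventually at most `n^ℓ 2^(-t)`, which tends to `0`.

The probability estimate is a switching argument (`card_regularContaining_insert_mul_pow_le`). An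
edge `e` and `s-1` further edges, pairwise disjoint, are written as the rows of an `s × s` matrix
and replaced by its columns, which preserves all degrees. There are at least `M^(s-1)` forward
switchings with `M` of order `r n`, and at most `(r s^s)^s` backward ones. Iterating over the
prescribed edges gives the power `t`.

The model must also be nonempty, which `regularHypergraphs_nonempty` obtains by balancing degrees.
-/

/-! ### Existence of regular hypergraphs -/

theorem sum_card_filter_mem {V : Type*} [Fintype V] [DecidableEq V] {s : ℕ}
    {E : Finset (Finset V)} (hE : ∀ e ∈ E, e.card = s) :
    ∑ v, (E.filter fun e => v ∈ e).card = E.card * s := by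
  have h := Finset.sum_card_bipartiteAbove_eq_sum_card_bipartiteBelow
    (s := (Finset.univ : Finset V)) (t := E) (fun v e => v ∈ e)
  simp only [Finset.bipartiteAbove, Finset.bipartiteBelow] at h
  rw [h, ← smul_eq_mul]
  exact Finset.sum_eq_card_nsmul fun e he => by simpa using hE e he

/-- Otherwise replacing `u` by `v`, in the edges that miss `v`, would inject the edges at `u` into
the edges at `v`. -/
theorem exists_exchange_edge {V : Type*} [DecidableEq V] {E : Finset (Finset V)} {u v : V}
    (h : (E.filter fun e => v ∈ e).card < (E.filter fun e => u ∈ e).card) :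
    ∃ e ∈ E, u ∈ e ∧ v ∉ e ∧ insert v (e.erase u) ∉ E := by
  by_contra! hcon
  refine absurd h (not_lt.2 ?_)
  refine Finset.card_le_card_of_injOn
    (fun e => if v ∈ e then e else insert v (e.erase u)) ?_ ?_
  · intro e he
    simp only [Finset.coe_filter, Set.mem_ofPred_eq] at he ⊢
    split_ifs with hv
    · exact ⟨he.1, hv⟩
    · exact ⟨hcon e he.1 he.2 hv, Finset.mem_insert_self _ _⟩
  · intro e he f hf hef
    simp only [Finset.coe_filter, Set.mem_ofPred_eq] at he hf
    dsimp only at hef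
    have key : ∀ g : Finset V, u ∈ g → v ∉ g → u ∉ insert v (g.erase u) ∧
        insert u ((insert v (g.erase u)).erase v) = g := by
      intro g hu hv
      have huv : u ≠ v := fun h => hv (h ▸ hu)
      refine ⟨by simp [huv], ?_⟩
      rw [Finset.erase_insert (by simp [hv]), Finset.insert_erase hu]
    split_ifs at hef with h1 h2 h2
    · exact hef
    · exact absurd (hef ▸ he.2) (key f hf.2 h2).1
    · exact absurd (hef ▸ hf.2) (key e he.2 h1).1
    · rw [← (key e he.2 h1).2, ← (key f hf.2 h2).2, hef]

/-- Among the `s`-uniform edge sets of the right size, one minimising the sum of squared degrees is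
regular: otherwise an exchange from a vertex of degree above `r` to one of degree below `r` lowers
the sum. -/
theorem regularHypergraphs_nonempty {n r s : ℕ} (hdvd : s ∣ r * n)
    (hle : r * n / s ≤ n.choose s) : (regularHypergraphs n r s).Nonempty := by
  classical
  obtain ⟨E, hE, hmin⟩ := Finset.exists_min_image
    (Finset.powersetCard (r * n / s) (Finset.powersetCard s (Finset.univ : Finset (Fin n))))
    (fun E => ∑ v, ((E.filter fun e => v ∈ e).card : ℤ) ^ 2)
    (Finset.powersetCard_nonempty.2 (by simpa using hle))
  rw [Finset.mem_powersetCard] at hE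
  obtain ⟨hsub, hcard⟩ := hE
  have hs : ∀ e ∈ E, e.card = s := fun e he => (Finset.mem_powersetCard.1 (hsub he)).2
  refine ⟨E, by
    simp only [regularHypergraphs, Finset.mem_filter, Finset.mem_univ, true_and]
    refine ⟨hs, ?_⟩
    by_contra hne
    have hsum : ∑ v, (E.filter fun e => v ∈ e).card = ∑ _v : Fin n, r := by
      rw [sum_card_filter_mem hs, hcard, Nat.div_mul_cancel hdvd]
      simp [mul_comm]
    obtain ⟨u, hu⟩ : ∃ u, r < (E.filter fun e => u ∈ e).card := by
      by_contra! hcon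
      exact hne fun v => (Finset.sum_eq_sum_iff_of_le fun i _ => hcon i).1 hsum v
        (Finset.mem_univ v)
    obtain ⟨v, hv⟩ : ∃ v, (E.filter fun e => v ∈ e).card < r := by
      by_contra! hcon
      exact hne fun v => ((Finset.sum_eq_sum_iff_of_le fun i _ => hcon i).1 hsum.symm v
        (Finset.mem_univ v)).symm
    obtain ⟨e, he, hue, hve, hnew⟩ := exists_exchange_edge (hv.trans hu)
    have huv : u ≠ v := fun h => hve (h ▸ hue)
    have hdeg : ∀ w, (((insert (insert v (e.erase u)) (E.erase e)).filter
        fun f => w ∈ f).card : ℤ) = (E.filter fun f => w ∈ f).card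
          + (if w = v then 1 else 0) - (if w = u then 1 else 0) := by
      intro w
      have h1 : (E.filter fun f => w ∈ f) =
          (if w ∈ e then insert e ((E.erase e).filter fun f => w ∈ f)
            else (E.erase e).filter fun f => w ∈ f) := by
        conv_lhs => rw [← Finset.insert_erase he, Finset.filter_insert]
      have h2 : insert v (e.erase u) ∉ (E.erase e).filter fun f => w ∈ f := by
        simp [hnew]
      rw [h1, Finset.filter_insert]
      by_cases hwv : w = v
      · subst hwv
        simp [hve, huv.symm, hnew]
      · by_cases hwu : w = u
        · subst hwu
          simp [hue, hwv]
        · by_cases hwe : w ∈ e <;> simp [hwv, hwu, hwe, hnew]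
    have hmem : insert (insert v (e.erase u)) (E.erase e) ∈ Finset.powersetCard (r * n / s)
        (Finset.powersetCard s (Finset.univ : Finset (Fin n))) := by
      rw [Finset.mem_powersetCard]
      constructor
      · intro f hf
        rcases Finset.mem_insert.1 hf with rfl | hf
        · rw [Finset.mem_powersetCard]
          refine ⟨Finset.subset_univ _, ?_⟩
          rw [Finset.card_insert_of_notMem (by simp [hve]), Finset.card_erase_add_one hue, hs e he]
        · exact hsub (Finset.mem_of_mem_erase hf)
      · rw [Finset.card_insert_of_notMem (by simp [hnew]), Finset.card_erase_add_one he, hcard]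
    have hlow := hmin _ hmem
    have hsq : ∀ w, (((E.filter fun f => w ∈ f).card : ℤ)
          + (if w = v then 1 else 0) - (if w = u then 1 else 0)) ^ 2
        = ((E.filter fun f => w ∈ f).card : ℤ) ^ 2
          + (if w = v then 2 * ((E.filter fun f => w ∈ f).card : ℤ) + 1 else 0)
          + (if w = u then 1 - 2 * ((E.filter fun f => w ∈ f).card : ℤ) else 0) := by
      intro w
      by_cases hwv : w = v
      · have : w ≠ u := fun h => huv (h ▸ hwv)
        simp only [if_pos hwv, if_neg this]; ring
      · by_cases hwu : w = u
        · simp only [if_neg hwv, if_pos hwu]; ring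
        · simp only [if_neg hwv, if_neg hwu]; ring
    -- The exchange changes the sum by `2(d(v) - d(u) + 1)`, negative because `d(v) < r < d(u)`.
    simp only [hdeg, hsq, Finset.sum_add_distrib, Finset.sum_ite_eq', Finset.mem_univ,
      if_true] at hlow
    have hu' : (r : ℤ) < (E.filter fun e => u ∈ e).card := by exact_mod_cast hu
    have hv' : ((E.filter fun e => v ∈ e).card : ℤ) < r := by exact_mod_cast hv
    linarith⟩

/-! ### The row-column switching -/

/-- The set of rows of a square matrix of vertices, each row being regarded as a set. -/
def rowSets {V : Type*} [DecidableEq V] {k : ℕ} (y : Fin k → Fin k → V) : Finset (Finset V) :=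
  Finset.univ.image fun j => Finset.univ.image (y j)

theorem rowSets_mem_iff {V : Type*} [DecidableEq V] {k : ℕ} {y : Fin k → Fin k → V}
    {e : Finset V} : e ∈ rowSets y ↔ ∃ j, Finset.univ.image (y j) = e := by
  simp [rowSets]

theorem filter_mem_rowSets {V : Type*} [DecidableEq V] {k : ℕ} {y : Fin k → Fin k → V}
    (hy : ∀ a b c d, y a b = y c d → a = c ∧ b = d) (a b : Fin k) :
    ((rowSets y).filter fun e => y a b ∈ e) = {Finset.univ.image (y a)} := by
  ext e
  simp only [Finset.mem_filter, rowSets_mem_iff, Finset.mem_singleton]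
  constructor
  · rintro ⟨⟨j, rfl⟩, h⟩
    obtain ⟨i, -, hi⟩ := Finset.mem_image.1 h
    rw [(hy _ _ _ _ hi).1]
  · rintro rfl
    exact ⟨⟨a, rfl⟩, Finset.mem_image_of_mem _ (Finset.mem_univ b)⟩

/-- With distinct entries, a vertex of the matrix lies in exactly one row and one column; any other
vertex lies in none. -/
theorem card_filter_mem_rowSets_transpose {V : Type*} [DecidableEq V] {k : ℕ}
    {y : Fin k → Fin k → V} (hy : ∀ a b c d, y a b = y c d → a = c ∧ b = d) (v : V) :
    ((rowSets y).filter fun e => v ∈ e).card =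
      ((rowSets fun i j => y j i).filter fun e => v ∈ e).card := by
  by_cases hv : ∃ a b, y a b = v
  · obtain ⟨a, b, rfl⟩ := hv
    rw [filter_mem_rowSets hy]
    have := filter_mem_rowSets (y := fun i j => y j i)
      (fun a b c d h => (hy _ _ _ _ h).symm) b a
    rw [this]
    simp
  · push Not at hv
    rw [Finset.filter_false_of_mem, Finset.filter_false_of_mem]
    · intro e he
      obtain ⟨j, rfl⟩ := rowSets_mem_iff.1 he
      simp [hv]
    · intro e he
      obtain ⟨j, rfl⟩ := rowSets_mem_iff.1 he
      simp [hv]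

theorem mem_regularHypergraphs {n r s : ℕ} {E : Finset (Finset (Fin n))} :
    E ∈ regularHypergraphs n r s ↔
      (∀ e ∈ E, e.card = s) ∧ ∀ v : Fin n, (E.filter fun e => v ∈ e).card = r := by
  simp [regularHypergraphs]

/-- Replacing the rows of a matrix of distinct vertices by its columns preserves regularity. -/
theorem switch_mem_regularHypergraphs {n r s : ℕ} {E : Finset (Finset (Fin n))}
    (hE : E ∈ regularHypergraphs n r s) {y : Fin s → Fin s → Fin n}
    (hy : ∀ a b c d, y a b = y c d → a = c ∧ b = d) (hrows : rowSets y ⊆ E)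
    (hcols : Disjoint E (rowSets fun i j => y j i)) :
    (E \ rowSets y) ∪ (rowSets fun i j => y j i) ∈ regularHypergraphs n r s := by
  rw [mem_regularHypergraphs] at hE ⊢
  constructor
  · intro e he
    rcases Finset.mem_union.1 he with he | he
    · exact hE.1 e (Finset.mem_sdiff.1 he).1
    · obtain ⟨j, rfl⟩ := rowSets_mem_iff.1 he
      rw [Finset.card_image_of_injective _ fun a b h => (hy _ _ _ _ h).1]
      simp
  · intro v
    have hsub : (rowSets y).filter (fun e => v ∈ e) ⊆ E.filter fun e => v ∈ e :=
      Finset.filter_subset_filter _ hrows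
    have hsd : (E \ rowSets y).filter (fun e => v ∈ e) =
        E.filter (fun e => v ∈ e) \ (rowSets y).filter fun e => v ∈ e := by
      ext e; simp only [Finset.mem_filter, Finset.mem_sdiff]; tauto
    rw [Finset.filter_union, Finset.card_union_of_disjoint, hsd,
      Finset.card_sdiff_of_subset hsub, ← card_filter_mem_rowSets_transpose hy,
      Nat.sub_add_cancel (Finset.card_le_card hsub), hE.2]
    exact Finset.disjoint_of_subset_left (Finset.filter_subset _ _)
      (Finset.disjoint_of_subset_right (Finset.filter_subset _ _)
        (Finset.disjoint_of_subset_left Finset.sdiff_subset hcols))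

/-! ### Counting forward and backward switchings -/

/-- The `k`-tuples of pairwise disjoint members of `E` outside `F` that avoid the set `B`. -/
def disjointTuples {V : Type*} [Fintype V] [DecidableEq V] (E F : Finset (Finset V)) (k : ℕ)
    (B : Finset V) : Finset (Fin k → Finset V) :=
  Finset.univ.filter fun f => (∀ j, f j ∈ E ∧ f j ∉ F ∧ Disjoint (f j) B) ∧
    ∀ i j, i ≠ j → Disjoint (f i) (f j)

theorem mem_disjointTuples {V : Type*} [Fintype V] [DecidableEq V] {E F : Finset (Finset V)}
    {k : ℕ} {B : Finset V} {f : Fin k → Finset V} :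
    f ∈ disjointTuples E F k B ↔ (∀ j, f j ∈ E ∧ f j ∉ F ∧ Disjoint (f j) B) ∧
      ∀ i j, i ≠ j → Disjoint (f i) (f j) := by
  simp [disjointTuples]

/-- Greedy choice: at most `|F| + r|B|` edges are excluded at each step, and the chosen edge then
joins `B`, enlarging it by at most `s` vertices. -/
theorem pow_le_card_disjointTuples {V : Type*} [Fintype V] [DecidableEq V]
    {E F : Finset (Finset V)} {r s : ℕ} (hE : ∀ e ∈ E, e.card = s)
    (hr : ∀ v, (E.filter fun e => v ∈ e).card ≤ r) (M k : ℕ) (B : Finset V)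
    (h : M + F.card + r * (B.card + k * s) ≤ E.card) :
    M ^ k ≤ (disjointTuples E F k B).card := by
  induction k generalizing B with
  | zero =>
    rw [pow_zero, Nat.one_le_iff_ne_zero, Finset.card_ne_zero]
    exact ⟨Fin.elim0, mem_disjointTuples.2 ⟨fun j => j.elim0, fun j => j.elim0⟩⟩
  | succ k ih =>
    set D := E.filter fun e => e ∉ F ∧ Disjoint e B with hD
    have hMD : M ≤ D.card := by
      have hcover : E ⊆ (D ∪ F) ∪ B.biUnion fun v => E.filter fun e => v ∈ e := by
        intro e he
        by_cases heF : e ∈ F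
        · simp [heF]
        by_cases heB : Disjoint e B
        · simp [hD, he, heF, heB]
        · obtain ⟨v, hve, hvB⟩ := Finset.not_disjoint_iff.1 heB
          refine Finset.mem_union_right _ (Finset.mem_biUnion.2 ⟨v, hvB, ?_⟩)
          simp [he, hve]
      have h1 := Finset.card_le_card hcover
      have h2 := Finset.card_union_le (D ∪ F) (B.biUnion fun v => E.filter fun e => v ∈ e)
      have h3 := Finset.card_union_le D F
      have h4 : (B.biUnion fun v => E.filter fun e => v ∈ e).card ≤ B.card * r :=
        Finset.card_biUnion_le_card_mul _ _ _ fun v _ => hr v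
      have h5 : r * (B.card + (k + 1) * s) = B.card * r + r * ((k + 1) * s) := by ring
      omega
    have hsig : D.card * M ^ k ≤ (D.sigma fun e => disjointTuples E F k (B ∪ e)).card := by
      rw [Finset.card_sigma, ← smul_eq_mul]
      refine Finset.card_nsmul_le_sum _ _ _ fun e he => ih _ ?_
      refine le_trans ?_ h
      have h6 := Finset.card_union_le B e
      rw [hE e (Finset.mem_filter.1 he).1] at h6
      have h7 : (B ∪ e).card + k * s ≤ B.card + (k + 1) * s := by
        rw [add_mul]; omega
      have := Nat.mul_le_mul_left r h7
      omega
    calc M ^ (k + 1) = M * M ^ k := by ring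
      _ ≤ D.card * M ^ k := Nat.mul_le_mul_right _ hMD
      _ ≤ _ := hsig
      _ ≤ _ := by
        refine Finset.card_le_card_of_injOn
          (fun p => (Fin.cons p.1 p.2 : Fin (k + 1) → Finset V)) ?_ ?_
        · rintro ⟨e, f⟩ hp
          simp only [Finset.coe_sigma, Set.mem_sigma_iff, Finset.mem_coe,
            mem_disjointTuples, hD, Finset.mem_filter] at hp
          obtain ⟨⟨heE, heF, heB⟩, hf, hff⟩ := hp
          simp only [Finset.mem_coe, mem_disjointTuples]
          constructor
          · intro j
            refine Fin.cases ?_ (fun j => ?_) j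
            · exact ⟨heE, heF, heB⟩
            · exact ⟨(hf j).1, (hf j).2.1, (Finset.disjoint_union_right.1 (hf j).2.2).1⟩
          · intro i j
            refine Fin.cases ?_ (fun i => ?_) i <;> refine Fin.cases ?_ (fun j => ?_) j
            · simp
            · intro _
              simpa using (Finset.disjoint_union_right.1 (hf j).2.2).2.symm
            · intro _
              simpa using (Finset.disjoint_union_right.1 (hf i).2.2).2
            · intro hij
              simpa using hff i j (fun h => hij (by rw [h]))
        · rintro ⟨e, f⟩ - ⟨e', f'⟩ - hef
          obtain ⟨rfl, rfl⟩ := Fin.cons_inj.1 hef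
          rfl

/-- Fixing one ordering per edge turns edges into matrix rows, so that the first row is determined
by `e` in the backward count. -/
theorem exists_enumeration (V : Type*) [DecidableEq V] [Nonempty V] (s : ℕ) :
    ∃ en : Finset V → Fin s → V, ∀ g, g.card = s →
      Function.Injective (en g) ∧ Finset.univ.image (en g) = g := by
  classical
  refine ⟨fun g => if h : g.card = s then fun i => ((g.equivFinOfCardEq h).symm i : V)
    else fun _ => Classical.arbitrary V, fun g hg => ?_⟩
  simp only [dif_pos hg]
  constructor
  · exact Subtype.val_injective.comp (Equiv.injective _)
  · ext v
    simp only [Finset.mem_image, Finset.mem_univ, true_and]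
    constructor
    · rintro ⟨i, rfl⟩
      exact ((g.equivFinOfCardEq hg).symm i).2
    · intro hv
      exact ⟨g.equivFinOfCardEq hg ⟨v, hv⟩, by simp⟩

/-- The number of matrices with prescribed first row all of whose columns are edges. -/
theorem card_matrices_columns_mem_le {V : Type*} [Fintype V] [DecidableEq V] {k r : ℕ}
    {E : Finset (Finset V)} (hE : ∀ e ∈ E, e.card = k + 1)
    (hr : ∀ v, (E.filter fun e => v ∈ e).card ≤ r) (x : Fin (k + 1) → V) :
    (Finset.univ.filter fun y : Fin (k + 1) → Fin (k + 1) → V =>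
      y 0 = x ∧ ∀ i, Finset.univ.image (fun j => y j i) ∈ E).card
      ≤ (r * (k + 1) ^ (k + 1)) ^ (k + 1) := by
  have hcol : ∀ v : V, (Finset.univ.filter fun c : Fin (k + 1) → V =>
      c 0 = v ∧ Finset.univ.image c ∈ E).card ≤ r * (k + 1) ^ (k + 1) := by
    intro v
    calc _ ≤ ((E.filter fun e => v ∈ e).biUnion fun e =>
          Fintype.piFinset fun _ : Fin (k + 1) => e).card := by
          refine Finset.card_le_card fun c hc => ?_
          simp only [Finset.mem_filter, Finset.mem_univ, true_and] at hc
          simp only [Finset.mem_biUnion, Finset.mem_filter, Fintype.mem_piFinset]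
          exact ⟨_, ⟨hc.2, hc.1 ▸ Finset.mem_image_of_mem _ (Finset.mem_univ _)⟩,
            fun j => Finset.mem_image_of_mem _ (Finset.mem_univ _)⟩
      _ ≤ (E.filter fun e => v ∈ e).card * (k + 1) ^ (k + 1) := by
          refine Finset.card_biUnion_le_card_mul _ _ _ fun e he => ?_
          simp [hE e (Finset.mem_filter.1 he).1]
      _ ≤ _ := Nat.mul_le_mul_right _ (hr v)
  calc _ ≤ (Fintype.piFinset fun i : Fin (k + 1) =>
        Finset.univ.filter fun c : Fin (k + 1) → V =>
          c 0 = x i ∧ Finset.univ.image c ∈ E).card := by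
        refine Finset.card_le_card_of_injOn (fun y i j => y j i) ?_ ?_
        · intro y hy
          simp only [Finset.coe_filter, Finset.mem_univ, true_and, Set.mem_ofPred_eq] at hy
          simp only [Finset.mem_coe, Fintype.mem_piFinset, Finset.mem_filter, Finset.mem_univ,
            true_and]
          exact fun i => ⟨congrFun hy.1 i, hy.2 i⟩
        · intro y _ z _ h
          funext j i
          exact congrFun (congrFun h i) j
    _ = ∏ i : Fin (k + 1), (Finset.univ.filter fun c : Fin (k + 1) → V =>
          c 0 = x i ∧ Finset.univ.image c ∈ E).card := Fintype.card_piFinset _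
    _ ≤ ∏ _i : Fin (k + 1), (r * (k + 1) ^ (k + 1)) :=
        Finset.prod_le_prod' fun i _ => hcol (x i)
    _ = _ := by simp

/-! ### Probability of containing prescribed edges -/

/-- The regular hypergraphs that contain a given set of edges. -/
def regularContaining (n r s : ℕ) (F : Finset (Finset (Fin n))) :
    Finset (Finset (Finset (Fin n))) :=
  (regularHypergraphs n r s).filter fun E => F ⊆ E

theorem card_mul_of_mem_regularHypergraphs {n r s : ℕ} {E : Finset (Finset (Fin n))}
    (hE : E ∈ regularHypergraphs n r s) : E.card * s = r * n := by
  rw [mem_regularHypergraphs] at hE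
  rw [← sum_card_filter_mem hE.1, Finset.sum_congr rfl fun v _ => hE.2 v]
  simp [mul_comm]

/-- The switching estimate: adding one edge to the set of prescribed edges. -/
theorem card_regularContaining_insert_mul_pow_le {n r k M : ℕ} (hk : 1 ≤ k)
    {F : Finset (Finset (Fin n))} {e : Finset (Fin n)} (heF : e ∉ F)
    (hM : (k + 1) * (M + F.card + r * ((k + 1) * r * (k + 1) + k * (k + 1))) ≤ r * n) :
    (regularContaining n r (k + 1) (insert e F)).card * M ^ k ≤
      (regularContaining n r (k + 1) F).card * (r * (k + 1) ^ (k + 1)) ^ (k + 1) := by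
  by_cases hempty : regularContaining n r (k + 1) (insert e F) = ∅
  · simp [hempty]
  obtain ⟨E₀, hE₀⟩ := Finset.nonempty_iff_ne_empty.2 hempty
  simp only [regularContaining, Finset.mem_filter] at hE₀
  have hecard : e.card = k + 1 :=
    (mem_regularHypergraphs.1 hE₀.1).1 e (hE₀.2 (Finset.mem_insert_self _ _))
  have hene : e.Nonempty := Finset.card_pos.1 (by omega)
  have : Nonempty (Fin n) := ⟨hene.choose⟩
  obtain ⟨en, hen⟩ := exists_enumeration (Fin n) (k + 1)
  -- The union of all edges meeting `e`. Rows chosen outside it are disjoint from `e`, and no column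
  -- can already be an edge.
  set B : Finset (Finset (Fin n)) → Finset (Fin n) := fun E =>
    (E.filter fun g => ¬ Disjoint g e).biUnion id with hB
  have hBcard : ∀ E ∈ regularHypergraphs n r (k + 1),
      (B E).card ≤ (k + 1) * r * (k + 1) := by
    intro E hE
    rw [mem_regularHypergraphs] at hE
    have h1 : (E.filter fun g => ¬ Disjoint g e).card ≤ (k + 1) * r := by
      calc _ ≤ (e.biUnion fun v => E.filter fun g => v ∈ g).card := by
            refine Finset.card_le_card fun g hg => ?_
            obtain ⟨hg, hge⟩ := Finset.mem_filter.1 hg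
            obtain ⟨v, hvg, hve⟩ := Finset.not_disjoint_iff.1 hge
            exact Finset.mem_biUnion.2 ⟨v, hve, Finset.mem_filter.2 ⟨hg, hvg⟩⟩
        _ ≤ e.card * r := Finset.card_biUnion_le_card_mul _ _ _ fun v _ => (hE.2 v).le
        _ = _ := by rw [hecard]
    calc (B E).card ≤ (E.filter fun g => ¬ Disjoint g e).card * (k + 1) :=
          Finset.card_biUnion_le_card_mul _ _ _ fun g hg =>
            (hE.1 g (Finset.mem_filter.1 hg).1).le
      _ ≤ _ := Nat.mul_le_mul_right _ h1
  have hsource : (regularContaining n r (k + 1) (insert e F)).card * M ^ k ≤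
      ((regularContaining n r (k + 1) (insert e F)).sigma fun E =>
        disjointTuples E F k (B E)).card := by
    rw [Finset.card_sigma, ← smul_eq_mul]
    refine Finset.card_nsmul_le_sum _ _ _ fun E hE => ?_
    simp only [regularContaining, Finset.mem_filter] at hE
    refine pow_le_card_disjointTuples (mem_regularHypergraphs.1 hE.1).1
      (fun v => ((mem_regularHypergraphs.1 hE.1).2 v).le) M k _ ?_
    have h1 := Nat.mul_le_mul_left r (Nat.add_le_add_right (hBcard E hE.1) (k * (k + 1)))
    have h2 := card_mul_of_mem_regularHypergraphs hE.1
    rw [← h2, mul_comm E.card] at hM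
    have h3 := Nat.le_of_mul_le_mul_left hM (Nat.succ_pos k)
    omega
  have htarget : ((regularContaining n r (k + 1) F).sigma fun E =>
      Finset.univ.filter fun y : Fin (k + 1) → Fin (k + 1) → Fin n =>
        y 0 = en e ∧ ∀ i, Finset.univ.image (fun j => y j i) ∈ E).card ≤
      (regularContaining n r (k + 1) F).card * (r * (k + 1) ^ (k + 1)) ^ (k + 1) := by
    rw [Finset.card_sigma, ← smul_eq_mul]
    refine Finset.sum_le_card_nsmul _ _ _ fun E hE => ?_
    simp only [regularContaining, Finset.mem_filter] at hE
    exact card_matrices_columns_mem_le (mem_regularHypergraphs.1 hE.1).1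
      (fun v => ((mem_regularHypergraphs.1 hE.1).2 v).le) _
  refine hsource.trans (le_trans ?_ htarget)
  set Y : (Fin k → Finset (Fin n)) → Fin (k + 1) → Fin (k + 1) → Fin n := fun f =>
    Fin.cons (en e) fun j => en (f j) with hY
  have key : ∀ E ∈ regularContaining n r (k + 1) (insert e F),
      ∀ f ∈ disjointTuples E F k (B E),
        (∀ a b c d, Y f a b = Y f c d → a = c ∧ b = d) ∧ rowSets (Y f) ⊆ E ∧
        Disjoint (rowSets (Y f)) F ∧ Disjoint E (rowSets fun i j => Y f j i) ∧
        ∀ j, f j = Finset.univ.image (Y f j.succ) := by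
    intro E hE f hf
    simp only [regularContaining, Finset.mem_filter] at hE
    obtain ⟨hEreg, hFE⟩ := hE
    rw [mem_regularHypergraphs] at hEreg
    obtain ⟨hf, hff⟩ := mem_disjointTuples.1 hf
    have heE : e ∈ E := hFE (Finset.mem_insert_self _ _)
    have heB : e ⊆ B E := fun v hv => Finset.mem_biUnion.2
      ⟨e, Finset.mem_filter.2 ⟨heE, Finset.not_disjoint_iff.2 ⟨v, hv, hv⟩⟩, hv⟩
    have hrow : ∀ j, Finset.univ.image (Y f j) = (Fin.cons e f : Fin (k + 1) → _) j := by
      intro j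
      refine Fin.cases ?_ (fun j => ?_) j
      · exact (hen e hecard).2
      · exact (hen (f j) (hEreg.1 _ (hf j).1)).2
    have hinj : ∀ j, Function.Injective (Y f j) := by
      intro j
      refine Fin.cases ?_ (fun j => ?_) j
      · exact (hen e hecard).1
      · exact (hen (f j) (hEreg.1 _ (hf j).1)).1
    have hmemY : ∀ a b, Y f a b ∈ (Fin.cons e f : Fin (k + 1) → Finset (Fin n)) a := by
      intro a b
      rw [← hrow]
      exact Finset.mem_image_of_mem _ (Finset.mem_univ _)
    have hdisj : ∀ a c, a ≠ c → Disjoint ((Fin.cons e f : Fin (k + 1) → Finset (Fin n)) a)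
        ((Fin.cons e f : Fin (k + 1) → Finset (Fin n)) c) := by
      intro a c
      refine Fin.cases ?_ (fun a => ?_) a <;> refine Fin.cases ?_ (fun c => ?_) c
      · simp
      · intro _
        exact Finset.disjoint_of_subset_left heB (hf c).2.2.symm
      · intro _
        exact Finset.disjoint_of_subset_right heB (hf a).2.2
      · intro hac
        exact hff a c fun h => hac (by rw [h])
    refine ⟨?_, ?_, ?_, ?_, ?_⟩
    · intro a b c d h
      have hac : a = c := by
        by_contra hac
        exact Finset.disjoint_left.1 (hdisj a c hac) (hmemY a b) (h ▸ hmemY c d)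
      subst hac
      exact ⟨rfl, hinj a h⟩
    · intro g hg
      obtain ⟨j, rfl⟩ := rowSets_mem_iff.1 hg
      rw [hrow]
      refine Fin.cases ?_ (fun j => ?_) j
      · exact heE
      · exact (hf j).1
    · rw [Finset.disjoint_left]
      intro g hg
      obtain ⟨j, rfl⟩ := rowSets_mem_iff.1 hg
      rw [hrow]
      refine Fin.cases ?_ (fun j => ?_) j
      · exact heF
      · exact (hf j).2.1
    · rw [Finset.disjoint_right]
      intro g hg hgE
      obtain ⟨i, rfl⟩ := rowSets_mem_iff.1 hg
      have hmem : ∀ j, Y f j i ∈ Finset.univ.image fun j => Y f j i :=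
        fun j => Finset.mem_image_of_mem _ (Finset.mem_univ _)
      have hsubB : (Finset.univ.image fun j => Y f j i) ⊆ B E := fun v hv =>
        Finset.mem_biUnion.2 ⟨_, Finset.mem_filter.2
          ⟨hgE, Finset.not_disjoint_iff.2 ⟨Y f 0 i, hmem 0, hmemY 0 i⟩⟩, hv⟩
      -- A column that is an edge meets `e`, hence lies inside `B E`; but its second entry, present
      -- since `k ≥ 1`, belongs to a row avoiding `B E`.
      have hlast := hmemY (Fin.succ ⟨0, hk⟩) i
      rw [Fin.cons_succ] at hlast
      exact Finset.disjoint_left.1 (hf ⟨0, hk⟩).2.2 hlast (hsubB (hmem _))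
    · intro j
      rw [hrow, Fin.cons_succ]
  refine Finset.card_le_card_of_injOn
    (fun p => ⟨(p.1 \ rowSets (Y p.2)) ∪ (rowSets fun i j => Y p.2 j i), Y p.2⟩) ?_ ?_
  · rintro ⟨E, f⟩ hp
    simp only [Finset.coe_sigma, Set.mem_sigma_iff, Finset.mem_coe] at hp
    obtain ⟨h1, h2, h3, h4, -⟩ := key E hp.1 f hp.2
    have hE := hp.1
    simp only [regularContaining, Finset.mem_filter] at hE
    simp only [Finset.coe_sigma, Set.mem_sigma_iff, Finset.mem_coe, regularContaining,
      Finset.mem_filter, Finset.mem_univ, true_and]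
    refine ⟨⟨switch_mem_regularHypergraphs hE.1 h1 h2 h4, ?_⟩, rfl, fun i => ?_⟩
    · intro g hg
      exact Finset.mem_union_left _ (Finset.mem_sdiff.2
        ⟨hE.2 (Finset.mem_insert_of_mem hg), fun h => Finset.disjoint_left.1 h3 h hg⟩)
    · exact Finset.mem_union_right _ (rowSets_mem_iff.2 ⟨i, rfl⟩)
  · rintro ⟨E, f⟩ hp ⟨E', f'⟩ hp' h
    simp only [Finset.coe_sigma, Set.mem_sigma_iff, Finset.mem_coe] at hp hp'
    obtain ⟨-, h2, -, h4, h5⟩ := key E hp.1 f hp.2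
    obtain ⟨-, h2', -, h4', h5'⟩ := key E' hp'.1 f' hp'.2
    simp only [Sigma.mk.injEq, heq_eq_eq] at h
    obtain ⟨hE, hYY⟩ := h
    have hff : f = f' := by
      funext j
      rw [h5, h5', hYY]
    subst hff
    -- The matrix is part of the image, so the switching is undone by putting its rows back in place
    -- of its columns.
    have recover : ∀ D R C : Finset (Finset (Fin n)), R ⊆ D → Disjoint D C →
        (((D \ R) ∪ C) \ C) ∪ R = D := by
      intro D R C hRD hDC
      rw [Finset.union_sdiff_cancel_right (Finset.disjoint_of_subset_left Finset.sdiff_subset hDC),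
        Finset.sdiff_union_of_subset hRD]
    have : E = E' := by
      rw [← recover E _ _ h2 h4, hE, recover E' _ _ h2' h4']
    subst this
    rfl

/-- The bound `T` on the final size lets one `M` serve every step of the induction. -/
theorem card_regularContaining_mul_pow_le {n r k M T : ℕ} (hk : 1 ≤ k)
    (hM : (k + 1) * (M + T + r * ((k + 1) * r * (k + 1) + k * (k + 1))) ≤ r * n)
    {F : Finset (Finset (Fin n))} (hF : F.card ≤ T) :
    (regularContaining n r (k + 1) F).card * (M ^ k) ^ F.card ≤
      (regularHypergraphs n r (k + 1)).card *
        ((r * (k + 1) ^ (k + 1)) ^ (k + 1)) ^ F.card := by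
  induction F using Finset.induction_on with
  | empty => simp [regularContaining]
  | insert e F he ih =>
    rw [Finset.card_insert_of_notMem he] at hF ⊢
    have h1 := ih (by omega)
    have h2 := card_regularContaining_insert_mul_pow_le (M := M) hk he
      (le_trans (Nat.mul_le_mul_left _ (by omega)) hM)
    rw [pow_succ, pow_succ]
    calc _ = ((regularContaining n r (k + 1) (insert e F)).card * M ^ k) *
          (M ^ k) ^ F.card := by ring
      _ ≤ ((regularContaining n r (k + 1) F).card * (r * (k + 1) ^ (k + 1)) ^ (k + 1)) *
          (M ^ k) ^ F.card := Nat.mul_le_mul_right _ h2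
      _ = ((regularContaining n r (k + 1) F).card * (M ^ k) ^ F.card) *
          (r * (k + 1) ^ (k + 1)) ^ (k + 1) := by ring
      _ ≤ _ := Nat.mul_le_mul_right _ h1
      _ = _ := by ring

/-! ### Union bound over initial paths -/

theorem mul_add_lt_path_length {s ℓ t i j : ℕ} (hℓs : ℓ < s) (hi : i < t) (hj : j < s) :
    i * (s - ℓ) + j < t * (s - ℓ) + ℓ := by
  have h := Nat.mul_le_mul_right (s - ℓ) (Nat.succ_le_of_lt hi)
  rw [Nat.succ_mul] at h
  omega

/-- The first `t` edges along a cyclic ordering of the vertices. -/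
def initialEdges {n : ℕ} (s ℓ t : ℕ) (v : ZMod n ≃ Fin n) : Finset (Finset (Fin n)) :=
  (Finset.range t).image (cycleEdge s ℓ v)

/-- The path does not wrap around, so the first vertex of an edge lies in no later edge. -/
theorem card_initialEdges {n s ℓ t : ℕ} (hℓs : ℓ < s) (hn : t * (s - ℓ) + ℓ ≤ n)
    (v : ZMod n ≃ Fin n) : (initialEdges s ℓ t v).card = t := by
  have hne : ∀ i i', i < i' → i' < t → cycleEdge s ℓ v i ≠ cycleEdge s ℓ v i' := by
    intro i i' hii hi' h
    have hmem : v ((i * (s - ℓ) + 0 : ℕ) : ZMod n) ∈ cycleEdge s ℓ v i :=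
      Finset.mem_image.2 ⟨0, Finset.mem_range.2 (by omega), rfl⟩
    rw [h, cycleEdge, Finset.mem_image] at hmem
    obtain ⟨j, hj, hv⟩ := hmem
    have hc := v.injective hv
    rw [ZMod.natCast_eq_natCast_iff] at hc
    have h1 := mul_add_lt_path_length hℓs hi' (Finset.mem_range.1 hj)
    have h2 : i * (s - ℓ) + 0 < t * (s - ℓ) + ℓ :=
      mul_add_lt_path_length hℓs (hii.trans hi') (by omega)
    have h3 := Nat.ModEq.eq_of_lt_of_lt hc (h1.trans_le hn) (h2.trans_le hn)
    have h4 := Nat.mul_lt_mul_of_pos_right hii (show 0 < s - ℓ by omega)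
    omega
  rw [initialEdges, Finset.card_image_of_injOn, Finset.card_range]
  intro i hi i' hi' h
  rw [Finset.mem_coe, Finset.mem_range] at hi hi'
  rcases lt_trichotomy i i' with hlt | heq | hlt
  · exact absurd h (hne _ _ hlt hi')
  · exact heq
  · exact absurd h.symm (hne _ _ hlt hi)

/-- The path depends only on its first `t(s-ℓ)+ℓ` vertices. The default value `0` in `G` is never
reached. -/
theorem card_image_initialEdges_le {n s ℓ t : ℕ} [NeZero n] (hℓs : ℓ < s) :
    (Finset.univ.image fun v : ZMod n ≃ Fin n => initialEdges s ℓ t v).card ≤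
      n ^ (t * (s - ℓ) + ℓ) := by
  classical
  set G : (Fin (t * (s - ℓ) + ℓ) → Fin n) → Finset (Finset (Fin n)) := fun w =>
    (Finset.range t).image fun i => (Finset.range s).image fun j =>
      if h : i * (s - ℓ) + j < t * (s - ℓ) + ℓ then w ⟨i * (s - ℓ) + j, h⟩ else 0 with hG
  calc _ ≤ (Finset.univ.image G).card := by
        refine Finset.card_le_card fun F hF => ?_
        obtain ⟨v, -, rfl⟩ := Finset.mem_image.1 hF
        refine Finset.mem_image.2 ⟨fun a => v ((a : ℕ) : ZMod n), Finset.mem_univ _, ?_⟩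
        refine Finset.image_congr fun i hi => ?_
        refine Finset.image_congr fun j hj => ?_
        simp only [Finset.coe_range, Set.mem_Iio] at hi hj
        rw [dif_pos (mul_add_lt_path_length hℓs hi hj)]
    _ ≤ _ := Finset.card_image_le
    _ = _ := by simp

open Classical in
theorem card_filter_hasOverlappingHamiltonCycle_mul_le {n r k ℓ t M : ℕ} (hn : 0 < n)
    (hk : 1 ≤ k) (hℓk : ℓ ≤ k) (htn : t * (k + 1 - ℓ) + ℓ ≤ n)
    (hM : (k + 1) * (M + t + r * ((k + 1) * r * (k + 1) + k * (k + 1))) ≤ r * n) :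
    ((regularHypergraphs n r (k + 1)).filter
      (HasOverlappingHamiltonCycle (k + 1) ℓ)).card * (M ^ k) ^ t ≤
      n ^ (t * (k + 1 - ℓ) + ℓ) * ((regularHypergraphs n r (k + 1)).card *
        ((r * (k + 1) ^ (k + 1)) ^ (k + 1)) ^ t) := by
  have : NeZero n := ⟨hn.ne'⟩
  set S := Finset.univ.image fun v : ZMod n ≃ Fin n => initialEdges (k + 1) ℓ t v
  calc _ ≤ (S.biUnion fun F => regularContaining n r (k + 1) F).card * (M ^ k) ^ t := by
        refine Nat.mul_le_mul_right _ (Finset.card_le_card fun E hE => ?_)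
        obtain ⟨hE, C, hCE, -, -, v, rfl⟩ := Finset.mem_filter.1 hE
        refine Finset.mem_biUnion.2 ⟨_, Finset.mem_image.2 ⟨v, Finset.mem_univ _, rfl⟩,
          Finset.mem_filter.2 ⟨hE, subset_trans ?_ hCE⟩⟩
        refine Finset.image_subset_image (Finset.range_subset_range.2 ?_)
        rw [Nat.le_div_iff_mul_le (by omega)]
        omega
    _ ≤ (∑ F ∈ S, (regularContaining n r (k + 1) F).card) * (M ^ k) ^ t :=
        Nat.mul_le_mul_right _ Finset.card_biUnion_le
    _ = ∑ F ∈ S, (regularContaining n r (k + 1) F).card * (M ^ k) ^ t := Finset.sum_mul _ _ _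
    _ ≤ S.card • ((regularHypergraphs n r (k + 1)).card *
        ((r * (k + 1) ^ (k + 1)) ^ (k + 1)) ^ t) := by
        refine Finset.sum_le_card_nsmul _ _ _ fun F hF => ?_
        obtain ⟨v, -, rfl⟩ := Finset.mem_image.1 hF
        have hc := card_initialEdges (s := k + 1) (t := t) (by omega) htn v
        have := card_regularContaining_mul_pow_le hk hM hc.le
        rwa [hc] at this
    _ ≤ _ := by
        rw [smul_eq_mul]
        exact Nat.mul_le_mul_right _ (card_image_initialEdges_le (by omega))

open Classical in
theorem card_filter_hasOverlappingHamiltonCycle_mul_two_pow_le {n r k ℓ : ℕ} (hk : 1 ≤ k)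
    (hℓ : 2 ≤ ℓ) (hℓk : ℓ ≤ k) (hr : 1 ≤ r) (hn : 4 * (k + 1) ≤ n)
    (hrn : 2 * ((k + 1) * ((k + 1) * r * (k + 1) + k * (k + 1))) ≤ n)
    (hrn' : 2 * (((k + 1) ^ (k + 1)) ^ (k + 1) * (8 * (k + 1)) ^ k) * r ≤ n) :
    ((regularHypergraphs n r (k + 1)).filter
      (HasOverlappingHamiltonCycle (k + 1) ℓ)).card * 2 ^ (n / (4 * (k + 1))) ≤
      n ^ ℓ * (regularHypergraphs n r (k + 1)).card := by
  set A := ((regularHypergraphs n r (k + 1)).filter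
      (HasOverlappingHamiltonCycle (k + 1) ℓ)).card
  set R := (regularHypergraphs n r (k + 1)).card
  set t := n / (4 * (k + 1)) with ht
  have ht1 : 1 ≤ t := (Nat.one_le_div_iff (by omega)).2 hn
  have htn : t * (4 * (k + 1)) ≤ n := Nat.div_mul_le_self _ _
  have hnt : n ≤ 8 * (k + 1) * t := by
    have h1 := Nat.lt_mul_div_succ n (show 0 < 4 * (k + 1) by omega)
    rw [← ht] at h1
    nlinarith
  have hn0 : 0 < n := by omega
  -- With `M = r t`, the terms `M + t ≤ 2 r t` use at most half of the budget `r n`; `hrn` leaves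
  -- the other half for the vertices to be avoided.
  have hmain := card_filter_hasOverlappingHamiltonCycle_mul_le (n := n) (r := r) (k := k)
    (ℓ := ℓ) (t := t) (M := r * t) hn0 hk hℓk (by
      have h1 : t * (k + 1 - ℓ) ≤ t * (k + 1) := Nat.mul_le_mul_left _ (by omega)
      have h2 : t * (4 * (k + 1)) = 4 * (t * (k + 1)) := by ring
      omega) (by
      have h1 : t ≤ r * t := Nat.le_mul_of_pos_left _ hr
      have h2 : 2 * ((k + 1) * (t + t)) ≤ n := by linarith
      calc _ ≤ (k + 1) * (r * t + r * t + r * ((k + 1) * r * (k + 1) + k * (k + 1))) := by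
            gcongr
        _ = r * ((k + 1) * (t + t) + (k + 1) * ((k + 1) * r * (k + 1) + k * (k + 1))) := by
            ring
        _ ≤ _ := Nat.mul_le_mul_left _ (by omega))
  set K := ((k + 1) ^ (k + 1)) ^ (k + 1) * (8 * (k + 1)) ^ k with hK
  have hpos : 0 < (r ^ k * n ^ k) ^ t := by positivity
  refine Nat.le_of_mul_le_mul_right ?_ hpos
  -- This is where `ℓ ≥ 2` enters: a spare factor `n` is left to absorb `2 * K * r`.
  have hnk : n * n ^ (k + 1 - ℓ) ≤ n ^ k := by
    rw [← pow_succ']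
    exact Nat.pow_le_pow_right hn0 (by omega)
  calc A * 2 ^ t * (r ^ k * n ^ k) ^ t
      ≤ A * 2 ^ t * (r ^ k * (8 * (k + 1) * t) ^ k) ^ t := by gcongr
    _ = A * ((r * t) ^ k) ^ t * (2 * (8 * (k + 1)) ^ k) ^ t := by
        simp only [mul_pow]; ring
    _ ≤ n ^ (t * (k + 1 - ℓ) + ℓ) * (R * ((r * (k + 1) ^ (k + 1)) ^ (k + 1)) ^ t) *
        (2 * (8 * (k + 1)) ^ k) ^ t := Nat.mul_le_mul_right _ hmain
    _ = n ^ ℓ * R * (r ^ k * ((2 * K * r) * n ^ (k + 1 - ℓ))) ^ t := by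
        have h1 : n ^ (t * (k + 1 - ℓ) + ℓ) = n ^ ℓ * (n ^ (k + 1 - ℓ)) ^ t := by
          rw [pow_add, mul_comm t, pow_mul, mul_comm]
        have h2 : r ^ k * ((2 * K * r) * n ^ (k + 1 - ℓ)) =
            n ^ (k + 1 - ℓ) * (r * (k + 1) ^ (k + 1)) ^ (k + 1) * (2 * (8 * (k + 1)) ^ k) := by
          rw [hK, mul_pow r, pow_succ r]; ring
        rw [h1, h2, mul_pow _ (2 * (8 * (k + 1)) ^ k), mul_pow (n ^ (k + 1 - ℓ))]
        ring
    _ ≤ n ^ ℓ * R * (r ^ k * (n * n ^ (k + 1 - ℓ))) ^ t := by gcongr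
    _ ≤ n ^ ℓ * R * (r ^ k * n ^ k) ^ t := by gcongr

/-! ### Asymptotics and conclusion -/

theorem le_choose_of_lt {m k : ℕ} (hk : 1 ≤ k) (hkm : k < m) : m ≤ m.choose k := by
  induction m generalizing k with
  | zero => omega
  | succ m ih =>
    obtain ⟨k, rfl⟩ := Nat.exists_eq_succ_of_ne_zero (by omega : k ≠ 0)
    rw [Nat.succ_eq_add_one, Nat.choose_succ_succ]
    have h1 : 0 < m.choose k := Nat.choose_pos (by omega)
    rcases Nat.lt_or_ge (k + 1) m with h | h
    · have := ih (k := k + 1) (by omega) h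
      simp only [Nat.succ_eq_add_one] at *
      omega
    · obtain rfl : m = k + 1 := by omega
      simp

/-- From `(k+1) C(n,k+1) = n C(n-1,k) ≥ n(n-1) ≥ r n`. -/
theorem mul_div_le_choose {n r k : ℕ} (hk : 1 ≤ k) (hkn : k + 1 < n) (hr : r < n) :
    r * n / (k + 1) ≤ n.choose (k + 1) := by
  obtain ⟨m, rfl⟩ := Nat.exists_eq_succ_of_ne_zero (by omega : n ≠ 0)
  refine Nat.div_le_of_le_mul ?_
  have h1 := le_choose_of_lt hk (show k < m by omega)
  have h2 := Nat.add_one_mul_choose_eq m k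
  simp only [Nat.succ_eq_add_one] at *
  rw [mul_comm (k + 1), ← h2, mul_comm]
  exact Nat.mul_le_mul_left _ (by omega)

theorem probRegular_not {n r s : ℕ} (h : (regularHypergraphs n r s).Nonempty)
    (P : Finset (Finset (Fin n)) → Prop) :
    probRegular n r s (fun E => ¬ P E) = 1 - probRegular n r s P := by
  classical
  have h0 : ((regularHypergraphs n r s).card : ℝ) ≠ 0 := by
    exact_mod_cast (Finset.card_pos.2 h).ne'
  have h1 : (((regularHypergraphs n r s).filter P).card : ℝ) +
      ((regularHypergraphs n r s).filter fun E => ¬ P E).card =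
      (regularHypergraphs n r s).card := by
    exact_mod_cast Finset.card_filter_add_card_filter_not (s := regularHypergraphs n r s) P
  unfold probRegular
  rw [eq_sub_iff_add_eq, ← add_div, div_eq_one_iff_eq h0]
  rw [add_comm, ← h1]
  congr!

/-- Since `kappa s ≤ 1`, the hypothesis gives `r = o(n)`, the only growth condition the argument
needs. -/
theorem eventually_mul_le_of_isLittleO {l : Filter ℕ} {r : ℕ → ℕ} {s : ℕ} (hl : l ≤ atTop)
    (h : (fun n : ℕ => (r n : ℝ)) =o[l] (fun n : ℕ => (n : ℝ) ^ kappa s)) (K : ℕ) :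
    ∀ᶠ n in l, K * r n ≤ n := by
  have h1 := h.bound (show (0 : ℝ) < 1 / (K + 1) by positivity)
  filter_upwards [h1, hl (eventually_ge_atTop 1)] with n hn hn1
  have hn1' : (1 : ℝ) ≤ n := by exact_mod_cast hn1
  have hkappa : kappa s ≤ 1 := by unfold kappa; split_ifs <;> norm_num
  have h2 : (n : ℝ) ^ kappa s ≤ n := by
    simpa using Real.rpow_le_rpow_of_exponent_le hn1' hkappa
  rw [Real.norm_of_nonneg (by positivity), Real.norm_of_nonneg (by positivity),
    div_mul_eq_mul_div, one_mul, le_div_iff₀ (by positivity)] at hn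
  have h3 : ((K * r n : ℕ) : ℝ) ≤ (n : ℝ) := by
    push_cast
    nlinarith [Nat.cast_nonneg (α := ℝ) (r n)]
  exact_mod_cast h3

theorem theorem2 (s : ℕ) (hs : 3 ≤ s) (r : ℕ → ℕ) (ℓ : ℕ) (hℓ : 2 ≤ ℓ) (hℓs : ℓ ≤ s - 1)
    (hr : ∀ᶠ n in admissibleAtTop r s ℓ, 2 ≤ r n)
    (hrκ : (fun n : ℕ => (r n : ℝ)) =o[admissibleAtTop r s ℓ]
      (fun n : ℕ => (n : ℝ) ^ kappa s)) :
    Tendsto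
      (fun n : ℕ => probRegular n (r n) s fun E => ¬ HasOverlappingHamiltonCycle s ℓ E)
      (admissibleAtTop r s ℓ) (𝓝 1) := by
  classical
  obtain ⟨k, rfl⟩ : ∃ k, s = k + 1 := ⟨s - 1, by omega⟩
  have hl : admissibleAtTop r (k + 1) ℓ ≤ atTop := inf_le_left
  have hadm : ∀ᶠ n in admissibleAtTop r (k + 1) ℓ, n ∈ admissible r (k + 1) ℓ :=
    mem_inf_of_right (mem_principal_self _)
  -- Rounding down costs at most a factor 2, so `n ≤ 8(k+1)t` for `n ≥ 4(k+1)`, and `n^ℓ / 2^t` is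
  -- dominated by an expression in `t` alone.
  have hlim : Tendsto (fun n : ℕ => ((8 * (k + 1) : ℕ) : ℝ) ^ ℓ *
      (((n / (4 * (k + 1)) : ℕ) : ℝ) ^ ℓ / (2 : ℝ) ^ (n / (4 * (k + 1)))))
      (admissibleAtTop r (k + 1) ℓ) (𝓝 0) := by
    have h1 := (tendsto_pow_const_div_const_pow_of_one_lt ℓ (one_lt_two (α := ℝ))).comp
      (Nat.tendsto_div_const_atTop (show 4 * (k + 1) ≠ 0 by omega))
    simpa using ((h1.const_mul (((8 * (k + 1) : ℕ) : ℝ) ^ ℓ)).mono_left hl)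
  have hev : ∀ᶠ n in admissibleAtTop r (k + 1) ℓ,
      (regularHypergraphs n (r n) (k + 1)).Nonempty ∧
      probRegular n (r n) (k + 1) (HasOverlappingHamiltonCycle (k + 1) ℓ) ≤
        ((8 * (k + 1) : ℕ) : ℝ) ^ ℓ *
          (((n / (4 * (k + 1)) : ℕ) : ℝ) ^ ℓ / (2 : ℝ) ^ (n / (4 * (k + 1)))) := by
    filter_upwards [hadm, hr, hl (eventually_ge_atTop (4 * (k + 1))),
      eventually_mul_le_of_isLittleO hl hrκ (2 * ((k + 1) * ((k + 1) * (k + 1) + k * (k + 1)))),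
      eventually_mul_le_of_isLittleO hl hrκ
        (2 * (((k + 1) ^ (k + 1)) ^ (k + 1) * (8 * (k + 1)) ^ k)),
      eventually_mul_le_of_isLittleO hl hrκ 2] with n hn hr2 hn4 h1 h2 h3
    have hne : (regularHypergraphs n (r n) (k + 1)).Nonempty :=
      regularHypergraphs_nonempty hn.2.1 (mul_div_le_choose (by omega) (by omega) (by omega))
    refine ⟨hne, ?_⟩
    have hmain := card_filter_hasOverlappingHamiltonCycle_mul_two_pow_le (n := n) (r := r n)
      (k := k) (ℓ := ℓ) (by omega) hℓ (by omega) (by omega) hn4 (by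
        refine le_trans ?_ h1
        have : k * (k + 1) ≤ k * (k + 1) * r n := Nat.le_mul_of_pos_right _ (by omega)
        calc _ ≤ 2 * ((k + 1) * ((k + 1) * r n * (k + 1) + k * (k + 1) * r n)) := by gcongr
          _ = _ := by ring) h2
    have hnt : n ≤ 8 * (k + 1) * (n / (4 * (k + 1))) := by
      have h1 := Nat.lt_mul_div_succ n (show 0 < 4 * (k + 1) by omega)
      have h2 : 1 ≤ n / (4 * (k + 1)) := (Nat.one_le_div_iff (by omega)).2 hn4
      nlinarith
    have hR : (0 : ℝ) < (regularHypergraphs n (r n) (k + 1)).card := by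
      exact_mod_cast Finset.card_pos.2 hne
    have hmain' : (((regularHypergraphs n (r n) (k + 1)).filter
        (HasOverlappingHamiltonCycle (k + 1) ℓ)).card : ℝ) * 2 ^ (n / (4 * (k + 1))) ≤
        (n : ℝ) ^ ℓ * (regularHypergraphs n (r n) (k + 1)).card := by exact_mod_cast hmain
    have hnt' : (n : ℝ) ≤ ((8 * (k + 1) : ℕ) : ℝ) * ((n / (4 * (k + 1)) : ℕ) : ℝ) := by
      exact_mod_cast hnt
    rw [probRegular, div_le_iff₀ hR, ← mul_div_assoc, ← mul_pow, div_mul_eq_mul_div,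
      le_div_iff₀ (by positivity)]
    calc _ = (((regularHypergraphs n (r n) (k + 1)).filter
          (HasOverlappingHamiltonCycle (k + 1) ℓ)).card : ℝ) * 2 ^ (n / (4 * (k + 1))) := by
          congr!
      _ ≤ _ := hmain'
      _ ≤ _ := by gcongr
  have hzero : Tendsto (fun n : ℕ =>
      probRegular n (r n) (k + 1) (HasOverlappingHamiltonCycle (k + 1) ℓ))
      (admissibleAtTop r (k + 1) ℓ) (𝓝 0) :=
    tendsto_of_tendsto_of_tendsto_of_le_of_le' tendsto_const_nhds hlim
      (Eventually.of_forall fun n => by unfold probRegular; positivity)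
      (hev.mono fun n hn => hn.2)
  have hone := hzero.const_sub 1
  rw [sub_zero] at hone
  exact hone.congr' (hev.mono fun n hn => (probRegular_not hn.1 _).symm)
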